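/- **Theorem.** For $1\le i\le n$ consider the (possibly unstable) linear systems $x_{i,t+1}=A_ix_{i,t}+B_iw_{i,t}$, $y_{i,t}=C_ix_{i,t}+D_iw_{i,t}$ with real matrices, and let $z_i=L_ix_i\in\mathbb R^{q}$, $q\ge 1$, be the quantity to be estimated. Let $S_i$ be a diagonal selection matrix with diagonal entries in $\{0,1\}$, and let $\rho_i>0$, $\mu_i,\lambda\in\mathbb R$. For a gain $G_i$ consider the filter $\hat x_{i,t+1}=F_i\hat x_{i,t}+G_iy_{i,t}$, $\hat z_{i,t}=H_i\hat x_{i,t}+K_iy_{i,t}$ with $F_i=A_i-G_iC_i$, $H_i=L_i$, $K_i=0$. For a stable transfer function $T$ put $$\|T\|_2=\Big(\frac1{2\pi}\int_{-\pi}^{\pi}\mathrm{Tr}\big(T(e^{i\omega})^*T(e^{i\omega})\big)\,d\omega\Big)^{1/2},\qquad \|T\|_\infty=\operatorname*{ess\,sup}_{\omega\in[-\pi,\pi)}\sigma_{\max}\big(T(e^{i\omega})\big).$$ Fix $i$. Suppose that there exist real matrices $X_i,Y_i,\hat G_i$ such that $$\mathrm{Tr}(Y_iL_i^TL_i)<\mu_i,\qquad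 \begin{bmatrix}Y_i&I\\ I&X_i\end{bmatrix}\succ0,\qquad \begin{bmatrix}X_i&X_iA_i-\hat G_iC_i&X_iB_i-\hat G_iD_i\\ *&X_i&0\\ *&*&I\end{bmatrix}\succ0,$$ $$\begin{bmatrix}X_i&0&X_iA_i-\hat G_iC_i&\hat G_iC_iS_i\\ *&\frac{\lambda}{\rho_i^2}I&L_i&0\\ *&*&X_i&0\\ *&*&*&I\end{bmatrix}\succ0,$$ where $*$ denotes the blocks determined by symmetry and $\succ0$ means symmetric positive definite. Then there is a gain $G_i$ such that $A_i-G_iC_i$ is stable (all its eigenvalues have modulus less than $1$) and both the error constraint and the sensitivity constraint hold: $$\big\|L_i(zI-(A_i-G_iC_i))^{-1}(B_i-G_iD_i)\big\|_2^2\le\mu_i,\qquad \rho_i^2\,\big\|L_i(zI-(A_i-G_iC_i))^{-1}G_iC_iS_i\big\|_\infty^2\le\lambda .$$ Moreover, for every feasible triple $(X_i,Y_i,\hat G_i)$ the gain $G_i=X_i^{-1}\hat G_i$ has these properties. -/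

import Mathlib

open scoped Matrix

noncomputable section

/-- A discrete-time real linear system `x⁺ = A x + B u`, `y = C x + D u`
with `n` states, `m` inputs and `q` outputs. -/
structure StateSpace (n m q : ℕ) where
  A : Matrix (Fin n) (Fin n) ℝ
  B : Matrix (Fin n) (Fin m) ℝ
  C : Matrix (Fin q) (Fin n) ℝ
  D : Matrix (Fin q) (Fin m) ℝ

/-- A real matrix regarded as a complex matrix. -/
def toComplex {m n : ℕ} (M : Matrix (Fin m) (Fin n) ℝ) : Matrix (Fin m) (Fin n) ℂ :=
  M.map (fun x : ℝ => (x : ℂ))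

namespace StateSpace

variable {n m q : ℕ}

/-- The transfer function `z ↦ C (z I - A)⁻¹ B + D`. -/
def transfer (sys : StateSpace n m q) (z : ℂ) : Matrix (Fin q) (Fin m) ℂ :=
  toComplex sys.C * (z • (1 : Matrix (Fin n) (Fin n) ℂ) - toComplex sys.A)⁻¹ * toComplex sys.B
    + toComplex sys.D

/-- Discrete-time stability: all complex eigenvalues of `A` lie in the open unit disc. -/
def IsStable (sys : StateSpace n m q) : Prop :=
  ∀ z ∈ spectrum ℂ (toComplex sys.A), ‖z‖ < 1

end StateSpace

/-- The largest singular value of a complex matrix (Mathlib's singular values are listed in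
nonincreasing order, starting at index `0`). -/
def sigmaMax {q m : ℕ} (M : Matrix (Fin q) (Fin m) ℂ) : ℝ :=
  (Matrix.toEuclideanLin M).singularValues 0

/-- The `H₂` norm `((1 / 2π) ∫_{-π}^{π} Tr (T(e^{iω})* T(e^{iω})) dω)^{1/2}`, with values in
`[0, ∞]`. The integrand is a nonnegative real number. -/
def h2Norm {q m : ℕ} (T : ℂ → Matrix (Fin q) (Fin m) ℂ) : ENNReal :=
  (ENNReal.ofReal (1 / (2 * Real.pi)) *
    ∫⁻ ω in Set.Ico (-Real.pi) Real.pi,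
      ENNReal.ofReal
        (((T (Complex.exp (Complex.I * (ω : ℂ))))ᴴ * T (Complex.exp (Complex.I * (ω : ℂ)))).trace.re))
    ^ (1 / 2 : ℝ)

/-- The `H∞` norm `ess sup_{ω ∈ [-π, π)} σ_max (T(e^{iω}))`, with values in `[0, ∞]`. -/
def hinfNorm {q m : ℕ} (T : ℂ → Matrix (Fin q) (Fin m) ℂ) : ENNReal :=
  essSup (fun ω : ℝ => ENNReal.ofReal (sigmaMax (T (Complex.exp (Complex.I * (ω : ℂ))))))
    (MeasureTheory.volume.restrict (Set.Ico (-Real.pi) Real.pi))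

/-- The public data of one participant: dynamics `x⁺ = A x + B w`, measurements `y = C x + D w`,
quantity of interest `z = L x`, and the set `coords` of the state coordinates whose trajectories
are to be kept private. No stability of `A` is required. -/
structure Participant (nx nw ny nz : ℕ) where
  A : Matrix (Fin nx) (Fin nx) ℝ
  B : Matrix (Fin nx) (Fin nw) ℝ
  C : Matrix (Fin ny) (Fin nx) ℝ
  D : Matrix (Fin ny) (Fin nw) ℝ
  L : Matrix (Fin nz) (Fin nx) ℝ
  coords : Finset (Fin nx)

namespace Participant

variable {nx nw ny nz : ℕ}

/-- The selection matrix: diagonal, with entry `1` at the private coordinates, `0` elsewhere. -/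
def S (P : Participant nx nw ny nz) : Matrix (Fin nx) (Fin nx) ℝ :=
  Matrix.diagonal (fun j => if j ∈ P.coords then 1 else 0)

/-- The filter `x̂⁺ = F x̂ + G y`, `ẑ = H x̂ + K y` with `F = A - G C`, `H = L`, `K = 0`. -/
def filter (P : Participant nx nw ny nz) (G : Matrix (Fin nx) (Fin ny) ℝ) :
    StateSpace nx ny nz where
  A := P.A - G * P.C
  B := G
  C := P.L
  D := 0

/-- The dynamics of the estimation error of that filter: with `e = x - x̂`, one has
`e⁺ = (A - G C) e + (B - G D) w` and `z - ẑ = L e`. -/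
def errorSystem (P : Participant nx nw ny nz) (G : Matrix (Fin nx) (Fin ny) ℝ) :
    StateSpace nx nw nz where
  A := P.A - G * P.C
  B := P.B - G * P.D
  C := P.L
  D := 0

/-- The system from a variation `δx = S δx` of the private coordinates of the state trajectory to
the variation `δẑ` of the filter output: `δx̂⁺ = F δx̂ + G C S δx`, `δẑ = H δx̂ + K C S δx`. -/
def sensitivitySystem (P : Participant nx nw ny nz) (G : Matrix (Fin nx) (Fin ny) ℝ) :
    StateSpace nx nx nz where
  A := (P.filter G).A
  B := (P.filter G).B * P.C * P.S
  C := (P.filter G).C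
  D := (P.filter G).D * P.C * P.S

/-- The error constraint: the error dynamics is stable and
`‖L (zI - (A - G C))⁻¹ (B - G D)‖₂² ≤ μ`. -/
def H2Constraint (P : Participant nx nw ny nz) (G : Matrix (Fin nx) (Fin ny) ℝ) (μ : ℝ) : Prop :=
  (P.errorSystem G).IsStable ∧
    ((h2Norm (P.errorSystem G).transfer ^ 2 : ENNReal) : EReal) ≤ (μ : EReal)

/-- The sensitivity constraint: the filter is stable and
`ρ² ‖L (zI - (A - G C))⁻¹ G C S‖_∞² ≤ lam`. -/
def HinfConstraint (P : Participant nx nw ny nz) (G : Matrix (Fin nx) (Fin ny) ℝ)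
    (ρ lam : ℝ) : Prop :=
  (P.sensitivitySystem G).IsStable ∧
    ((ENNReal.ofReal (ρ ^ 2) * hinfNorm (P.sensitivitySystem G).transfer ^ 2 : ENNReal) : EReal)
      ≤ (lam : EReal)

/-- The symmetric block matrix `[Y, I; I, X]`. -/
def couplingBlock (X Y : Matrix (Fin nx) (Fin nx) ℝ) :
    Matrix (Fin nx ⊕ Fin nx) (Fin nx ⊕ Fin nx) ℝ :=
  Matrix.fromBlocks Y 1 1 X

/-- The symmetric block matrix
`[X, X A - Ĝ C, X B - Ĝ D; *, X, 0; *, *, I]`. -/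
def h2Block (P : Participant nx nw ny nz) (X : Matrix (Fin nx) (Fin nx) ℝ)
    (Ghat : Matrix (Fin nx) (Fin ny) ℝ) :
    Matrix (Fin nx ⊕ (Fin nx ⊕ Fin nw)) (Fin nx ⊕ (Fin nx ⊕ Fin nw)) ℝ :=
  Matrix.fromBlocks
    X (Matrix.fromCols (X * P.A - Ghat * P.C) (X * P.B - Ghat * P.D))
    (Matrix.fromRows (X * P.A - Ghat * P.C)ᵀ (X * P.B - Ghat * P.D)ᵀ)
    (Matrix.fromBlocks X 0 0 1)

/-- The symmetric block matrix
`[X, 0, X A - Ĝ C, Ĝ C S; *, (lam / ρ²) I, L, 0; *, *, X, 0; *, *, *, I]`. -/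
def hinfBlock (P : Participant nx nw ny nz) (X : Matrix (Fin nx) (Fin nx) ℝ)
    (Ghat : Matrix (Fin nx) (Fin ny) ℝ) (ρ lam : ℝ) :
    Matrix ((Fin nx ⊕ Fin nz) ⊕ (Fin nx ⊕ Fin nx)) ((Fin nx ⊕ Fin nz) ⊕ (Fin nx ⊕ Fin nx)) ℝ :=
  Matrix.fromBlocks
    (Matrix.fromBlocks X 0 0 ((lam / ρ ^ 2) • (1 : Matrix (Fin nz) (Fin nz) ℝ)))
    (Matrix.fromBlocks (X * P.A - Ghat * P.C) (Ghat * P.C * P.S) P.L 0)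
    (Matrix.fromBlocks (X * P.A - Ghat * P.C) (Ghat * P.C * P.S) P.L 0)ᵀ
    (Matrix.fromBlocks X 0 0 1)

/-- The linear matrix inequalities in the unknowns `X`, `Y`, `Ĝ`. Positive definiteness of a
block matrix includes its symmetry, hence that of `X` and `Y`. -/
def LMIs (P : Participant nx nw ny nz) (μ ρ lam : ℝ) (X Y : Matrix (Fin nx) (Fin nx) ℝ)
    (Ghat : Matrix (Fin nx) (Fin ny) ℝ) : Prop :=
  (Y * P.Lᵀ * P.L).trace < μ ∧
    (couplingBlock X Y).PosDef ∧
    (P.h2Block X Ghat).PosDef ∧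
    (P.hinfBlock X Ghat ρ lam).PosDef

end Participant

end

/-!
Write `F = A - G C`, `E = B - G D`, `M = G C S` for the gain `G = X⁻¹ Ĝ`, so that `X A - Ĝ C = X F`,
`X B - Ĝ D = X E` and `Ĝ C S = X M`.

* *Stability.* The block inequality for the error contains `Fᵀ X F < X`, which confines the spectrum
  of `F` to the open unit disc (`norm_lt_one_of_lyapunov`).
* *Error bound.* The Schur complement of the same inequality is `W ≥ F W Fᵀ + E Eᵀ` with `W = X⁻¹`.
  No Gramian and no Parseval identity is needed: on the unit circle, with `R = (z - F)⁻¹`, one has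
  `R (W - F W Fᴴ) Rᴴ = z R W + (z R W)ᴴ - W`, hence `R E Eᴴ Rᴴ ≤ z R W + (z R W)ᴴ - W`
  (`trace_gram_resolvent_le`). As a function of `w = z⁻¹`, the matrix `z R = (1 - w F)⁻¹` is
  holomorphic near the closed disc, so its mean over the circle is its value `1` at `w = 0`. Thus
  the mean of the right-hand side is `W`, and `‖L R E‖₂² ≤ Tr (L W Lᵀ)` (`h2Norm_sq_le`). The
  coupling inequality gives `W ≤ Y`, and `Tr (L Y Lᵀ) < μ`.
* *Sensitivity bound.* For `x = (z - F)⁻¹ M`, that is `F x + M = z x`, the last block inequality is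
  tested on the blocks `-z x`, `-γ⁻¹ L x`, `x`, `1` with `γ = λ / ρ²`. All terms in `X` cancel when
  `|z| = 1`, leaving `(L x)ᴴ (L x) ≤ γ` (`boundedReal_posSemidef`), which bounds the largest
  singular value of `L x` (`sigmaMax_sq_le`).
-/

section

open scoped ComplexOrder

/-! ### Complexification of real matrices -/

lemma toComplex_mul {m n p : ℕ} (M : Matrix (Fin m) (Fin n) ℝ) (N : Matrix (Fin n) (Fin p) ℝ) :
    toComplex (M * N) = toComplex M * toComplex N :=
  Matrix.map_mul (f := Complex.ofRealHom)

lemma toComplex_sub {m n : ℕ} (M N : Matrix (Fin m) (Fin n) ℝ) :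
    toComplex (M - N) = toComplex M - toComplex N :=
  Matrix.map_sub _ (fun a b => Complex.ofReal_sub a b) M N

lemma toComplex_transpose {m n : ℕ} (M : Matrix (Fin m) (Fin n) ℝ) :
    toComplex Mᵀ = (toComplex M)ᴴ := by
  ext i j
  simp [toComplex]

lemma toComplex_zero {m n : ℕ} : toComplex (0 : Matrix (Fin m) (Fin n) ℝ) = 0 := by
  ext i j
  simp [toComplex]

lemma trace_toComplex {n : ℕ} (M : Matrix (Fin n) (Fin n) ℝ) :
    (toComplex M).trace = (M.trace : ℂ) := by
  simp [toComplex, Matrix.trace]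

/-- A factorization `M = Bᵀ B` over the reals is also one over the complex numbers. -/
lemma Matrix.PosSemidef.map_ofReal {ι : Type*} [Fintype ι] {M : Matrix ι ι ℝ}
    (hM : M.PosSemidef) : (M.map (fun x : ℝ => (x : ℂ))).PosSemidef := by
  classical
  open scoped MatrixOrder in
  obtain ⟨B, rfl⟩ := CStarAlgebra.nonneg_iff_eq_star_mul_self.mp hM.nonneg
  have h : (star B * B).map (fun x : ℝ => (x : ℂ)) =
      (B.map (fun x : ℝ => (x : ℂ)))ᴴ * B.map (fun x : ℝ => (x : ℂ)) := by
    ext i j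
    simp [Matrix.mul_apply, Matrix.star_apply]
  rw [h]
  exact Matrix.posSemidef_conjTranspose_mul_self _

lemma Matrix.PosDef.map_ofReal {ι : Type*} [Fintype ι] {M : Matrix ι ι ℝ}
    (hM : M.PosDef) : (M.map (fun x : ℝ => (x : ℂ))).PosDef := by
  classical
  refine hM.posSemidef.map_ofReal.posDef_iff_isUnit.mpr ?_
  exact hM.isUnit.map Complex.ofRealHom.mapMatrix

/-! ### Discrete Lyapunov inequality and stability -/

/-- A strict Lyapunov inequality `Fᴴ X F < X` with `X > 0` confines the spectrum of `F` to the open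
unit disc: at an eigenvector `v` for `z` it reads `(1 - |z|²) v* X v > 0`. -/
lemma norm_lt_one_of_lyapunov {ι : Type*} [Fintype ι] [DecidableEq ι] {X F : Matrix ι ι ℂ}
    (hX : X.PosDef) (h : (X - Fᴴ * X * F).PosDef) {z : ℂ} (hz : z ∈ spectrum ℂ F) :
    ‖z‖ < 1 := by
  obtain ⟨v, hv0, hv⟩ : ∃ v : ι → ℂ, v ≠ 0 ∧ F *ᵥ v = z • v := by
    rw [spectrum.mem_iff, Matrix.isUnit_iff_isUnit_det, isUnit_iff_ne_zero, not_not] at hz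
    obtain ⟨v, hv0, hv⟩ := Matrix.exists_mulVec_eq_zero_iff.mpr hz
    refine ⟨v, hv0, ?_⟩
    rw [Matrix.sub_mulVec, Algebra.algebraMap_eq_smul_one, Matrix.smul_mulVec,
      Matrix.one_mulVec] at hv
    exact (sub_eq_zero.mp hv).symm
  have h1 := hX.dotProduct_mulVec_pos hv0
  have h2 := h.dotProduct_mulVec_pos hv0
  have key : star v ⬝ᵥ ((X - Fᴴ * X * F) *ᵥ v) =
      ((1 - ‖z‖ ^ 2 : ℝ) : ℂ) * (star v ⬝ᵥ (X *ᵥ v)) := by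
    have e : star v ⬝ᵥ ((Fᴴ * X * F) *ᵥ v) = star (F *ᵥ v) ⬝ᵥ (X *ᵥ (F *ᵥ v)) := by
      rw [Matrix.star_mulVec, ← Matrix.dotProduct_mulVec, Matrix.mulVec_mulVec,
        Matrix.mulVec_mulVec, Matrix.mul_assoc]
    rw [Matrix.sub_mulVec, dotProduct_sub, e, hv, Matrix.mulVec_smul, star_smul,
      smul_dotProduct, dotProduct_smul, smul_eq_mul, smul_eq_mul, ← mul_assoc]
    have : star z * z = ((‖z‖ ^ 2 : ℝ) : ℂ) := by
      push_cast
      exact Complex.conj_mul' z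
    rw [this]
    push_cast
    ring
  rw [key] at h2
  have h3 : (0 : ℝ) < 1 - ‖z‖ ^ 2 := by
    have := pos_of_mul_pos_left h2 h1.le
    exact_mod_cast this
  nlinarith [norm_nonneg z]

/-! ### The largest singular value -/

/-- `Mᴴ M ≤ γ` bounds the largest singular value of `M` by `√γ`. -/
lemma sigmaMax_sq_le {q m : ℕ} (M : Matrix (Fin q) (Fin m) ℂ) {γ : ℝ} (hγ : 0 ≤ γ)
    (h : ((γ : ℂ) • 1 - Mᴴ * M).PosSemidef) : sigmaMax M ^ 2 ≤ γ := by
  unfold sigmaMax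
  set T := Matrix.toEuclideanLin M
  -- Without inputs there are no singular values, and `singularValues 0` is `0` by convention.
  rcases Nat.eq_zero_or_pos (Module.finrank ℂ (EuclideanSpace ℂ (Fin m))) with h0 | h0
  · rw [T.singularValues_of_finrank_le h0.le]
    simpa using hγ
  obtain ⟨v, hv⟩ := (T.hasEigenvalue_adjoint_comp_self_sq_singularValues h0).exists_hasEigenvector
  have hv0 : v.ofLp ≠ 0 := fun e => hv.2 ((WithLp.ofLp_eq_zero 2).mp e)
  have hM : (Mᴴ * M) *ᵥ v.ofLp = ((T.singularValues 0 ^ 2 : ℝ) : ℂ) • v.ofLp := by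
    have := congrArg WithLp.ofLp hv.apply_eq_smul
    rw [← Matrix.toEuclideanLin_conjTranspose_eq_adjoint] at this
    simpa [T, Matrix.toLpLin_apply, Matrix.mulVec_mulVec] using this
  have h1 := h.dotProduct_mulVec_nonneg v.ofLp
  rw [Matrix.sub_mulVec, hM, Matrix.smul_mulVec, Matrix.one_mulVec, ← sub_smul, dotProduct_smul,
    smul_eq_mul, ← Complex.ofReal_sub] at h1
  have h2 : 0 < star v.ofLp ⬝ᵥ v.ofLp := Matrix.dotProduct_star_self_pos_iff.mpr hv0
  have h3 : (0 : ℂ) ≤ ((γ - T.singularValues 0 ^ 2 : ℝ) : ℂ) :=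
    le_of_mul_le_mul_right (by rwa [zero_mul]) h2
  have h4 : 0 ≤ γ - T.singularValues 0 ^ 2 := by exact_mod_cast h3
  linarith

/-! ### The bounded real inequality -/

/-- If `x` solves `z x = F x + M` with `|z| = 1`, the block inequality with output matrix `L` gives
`(L x)ᴴ (L x) ≤ γ`. The four test blocks `-z x`, `-γ⁻¹ L x`, `x`, `1` make the terms in `X` cancel
and optimize the terms in `γ`. -/
lemma boundedReal_posSemidef {ι κ ν : Type*} [Fintype ι] [Fintype κ] [Fintype ν] [DecidableEq κ]
    [DecidableEq ν] {X F : Matrix ι ι ℂ} {M : Matrix ι ν ℂ} {L : Matrix κ ι ℂ} {γ : ℝ}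
    (hγ : 0 < γ)
    (h : (Matrix.fromBlocks (Matrix.fromBlocks X 0 0 ((γ : ℂ) • (1 : Matrix κ κ ℂ)))
      (Matrix.fromBlocks (X * F) (X * M) L 0) (Matrix.fromBlocks (X * F) (X * M) L 0)ᴴ
      (Matrix.fromBlocks X 0 0 (1 : Matrix ν ν ℂ))).PosSemidef) (hX : X.IsHermitian)
    {z : ℂ} (hz : ‖z‖ = 1) {x : Matrix ι ν ℂ} (hx : F * x + M = z • x) :
    ((γ : ℂ) • 1 - (L * x)ᴴ * (L * x)).PosSemidef := by
  have hzz : star z * z = 1 := by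
    have := Complex.conj_mul' z
    rw [hz] at this
    simpa using this
  have hγ' : (γ : ℂ) ≠ 0 := by exact_mod_cast hγ.ne'
  have h1 := h.conjTranspose_mul_mul_same
    (Matrix.fromRows (Matrix.fromRows (-(z • x)) (-((γ : ℂ)⁻¹ • (L * x))))
      (Matrix.fromRows x (1 : Matrix ν ν ℂ)))
  have e1 : X * F * x + X * M = z • (X * x) := by
    rw [Matrix.mul_assoc, ← Matrix.mul_add, hx, Matrix.mul_smul]
  have e2 : xᴴ * (Fᴴ * X) + Mᴴ * X = star z • (xᴴ * X) := by
    have := congrArg Matrix.conjTranspose e1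
    simpa [Matrix.conjTranspose_mul, hX.eq] using this
  have key : (Matrix.fromRows (Matrix.fromRows (-(z • x)) (-((γ : ℂ)⁻¹ • (L * x))))
      (Matrix.fromRows x (1 : Matrix ν ν ℂ)))ᴴ *
      (Matrix.fromBlocks (Matrix.fromBlocks X 0 0 ((γ : ℂ) • (1 : Matrix κ κ ℂ)))
      (Matrix.fromBlocks (X * F) (X * M) L 0) (Matrix.fromBlocks (X * F) (X * M) L 0)ᴴ
      (Matrix.fromBlocks X 0 0 (1 : Matrix ν ν ℂ))) *
      (Matrix.fromRows (Matrix.fromRows (-(z • x)) (-((γ : ℂ)⁻¹ • (L * x))))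
      (Matrix.fromRows x (1 : Matrix ν ν ℂ))) = 1 - (γ : ℂ)⁻¹ • ((L * x)ᴴ * (L * x)) := by
    rw [Matrix.mul_assoc]
    simp only [Matrix.conjTranspose_fromRows_eq_fromCols_conjTranspose,
      Matrix.fromBlocks_mul_fromRows, Matrix.fromCols_mul_fromRows,
      Matrix.fromBlocks_conjTranspose, Matrix.conjTranspose_mul, Matrix.conjTranspose_neg,
      Matrix.conjTranspose_smul, Matrix.conjTranspose_zero, Matrix.conjTranspose_one,
      Matrix.zero_mul, Matrix.mul_one, add_zero, zero_add, hX.eq]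
    have e3 : xᴴ * (Fᴴ * (X * x)) + Mᴴ * (X * x) = star z • (xᴴ * (X * x)) := by
      have := congrArg (· * x) e2
      simpa [Matrix.add_mul, Matrix.mul_assoc] using this
    rw [e1, Matrix.mul_add, Matrix.mul_add]
    have hγs : star (γ : ℂ)⁻¹ = (γ : ℂ)⁻¹ := by simp
    simp only [Matrix.fromCols_mul_fromRows, hγs, Matrix.mul_neg, Matrix.neg_mul, Matrix.mul_smul,
      Matrix.smul_mul, Matrix.mul_add, Matrix.mul_one, Matrix.one_mul, smul_neg, neg_neg,
      Matrix.mul_assoc]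
    generalize xᴴ * (X * x) = U at e3 ⊢
    generalize xᴴ * (Lᴴ * (L * x)) = V
    generalize xᴴ * (Fᴴ * (X * x)) = U₁ at e3 ⊢
    generalize Mᴴ * (X * x) = U₂ at e3 ⊢
    have hγ2 := mul_inv_cancel₀ hγ'
    linear_combination (norm := module) (-z) • e3 - hzz • U + ((γ : ℂ)⁻¹ * hγ2) • V
  rw [key] at h1
  have h2 := h1.smul (show (0 : ℂ) ≤ γ by exact_mod_cast hγ.le)
  rwa [smul_sub, smul_smul, mul_inv_cancel₀ hγ', one_smul] at h2

/-! ### The mean value of the resolvent -/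

lemma isUnit_one_sub_smul {ι : Type*} [Fintype ι] [DecidableEq ι] {F : Matrix ι ι ℂ}
    (hF : ∀ z ∈ spectrum ℂ F, ‖z‖ < 1) {w : ℂ} (hw : ‖w‖ ≤ 1) : IsUnit (1 - w • F) := by
  rcases eq_or_ne w 0 with rfl | h0
  · simp
  have h1 : w⁻¹ ∉ spectrum ℂ F := fun h => by
    have := hF _ h
    rw [norm_inv] at this
    exact absurd this (not_lt.mpr ((one_le_inv₀ (norm_pos_iff.mpr h0)).mpr hw))
  rw [spectrum.notMem_iff, Algebra.algebraMap_eq_smul_one] at h1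
  have h2 : 1 - w • F = (Units.mk0 w h0) • (w⁻¹ • (1 : Matrix ι ι ℂ) - F) := by
    rw [Units.smul_mk0, smul_sub, smul_smul, mul_inv_cancel₀ h0, one_smul]
  rw [h2]
  exact h1.smul _

section

-- Any complete normed algebra structure on matrices serves to differentiate the inverse.
attribute [local instance] Matrix.linftyOpNormedRing Matrix.linftyOpNormedAlgebra

lemma differentiableAt_trace_mul_inv_mul {ι κ : Type*} [Fintype ι] [DecidableEq ι] [Fintype κ]
    {F : Matrix ι ι ℂ} (hF : ∀ z ∈ spectrum ℂ F, ‖z‖ < 1) (A : Matrix κ ι ℂ) (B : Matrix ι κ ℂ)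
    {w : ℂ} (hw : ‖w‖ ≤ 1) :
    DifferentiableAt ℂ (fun w : ℂ => (A * (1 - w • F)⁻¹ * B).trace) w := by
  have h1 : DifferentiableAt ℂ (fun w : ℂ => (1 - w • F)⁻¹) w := by
    simp only [Matrix.nonsing_inv_eq_ringInverse]
    exact (differentiableAt_inverse (isUnit_one_sub_smul hF hw)).comp w
      (by fun_prop : DifferentiableAt ℂ (fun w : ℂ => 1 - w • F) w)
  let φ : Matrix ι ι ℂ →ₗ[ℂ] ℂ :=
    { toFun := fun N => (A * N * B).trace
      map_add' := fun N N' => by simp [Matrix.mul_add, Matrix.add_mul]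
      map_smul' := fun c N => by simp }
  exact (LinearMap.toContinuousLinearMap φ).differentiableAt.comp w h1

end

/-- Mean value property of `w ↦ Tr (A (1 - w F)⁻¹ B)`, holomorphic near the closed unit disc. -/
lemma circleAverage_trace_mul_inv_mul {ι κ : Type*} [Fintype ι] [DecidableEq ι] [Fintype κ]
    {F : Matrix ι ι ℂ} (hF : ∀ z ∈ spectrum ℂ F, ‖z‖ < 1) (A : Matrix κ ι ℂ) (B : Matrix ι κ ℂ) :
    Real.circleAverage (fun w : ℂ => (A * (1 - w • F)⁻¹ * B).trace) 0 1 = (A * B).trace := by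
  have h : DifferentiableOn ℂ (fun w : ℂ => (A * (1 - w • F)⁻¹ * B).trace)
      (Metric.closedBall 0 |1|) := fun w hw =>
    (differentiableAt_trace_mul_inv_mul hF A B (by simpa using hw)).differentiableWithinAt
  rw [(h.mono Metric.closure_ball_subset_closedBall).diffContOnCl.circleAverage]
  simp

/-- The normalized integral over `[-π, π)` in the definition of `h2Norm` is bounded by the circle
average of a continuous majorant. -/
lemma lintegral_le_circleAverage {φ ψ : ℂ → ℝ} (h0 : ∀ z : ℂ, ‖z‖ = 1 → 0 ≤ φ z)
    (h1 : ∀ z : ℂ, ‖z‖ = 1 → φ z ≤ ψ z) (hψ : ContinuousOn ψ (Metric.sphere 0 1)) :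
    ENNReal.ofReal (1 / (2 * Real.pi)) * ∫⁻ ω in Set.Ico (-Real.pi) Real.pi,
      ENNReal.ofReal (φ (Complex.exp (Complex.I * (ω : ℂ)))) ≤
    ENNReal.ofReal (Real.circleAverage ψ 0 1) := by
  have hπ := Real.pi_pos
  have hn : ∀ ω : ℝ, ‖circleMap 0 1 ω‖ = 1 := fun ω => by simp
  have hc : ∀ ω : ℝ, Complex.exp (Complex.I * (ω : ℂ)) = circleMap 0 1 ω := fun ω => by
    simp [circleMap, mul_comm]
  have hcont : Continuous (fun ω : ℝ => ψ (circleMap 0 1 ω)) :=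
    hψ.comp_continuous (continuous_circleMap 0 1) (fun ω => by simp)
  have hint : MeasureTheory.IntegrableOn (fun ω : ℝ => ψ (circleMap 0 1 ω))
      (Set.Ico (-Real.pi) Real.pi) :=
    (hcont.integrableOn_Icc (a := -Real.pi) (b := Real.pi)).mono_set Set.Ico_subset_Icc_self
  have havg : Real.circleAverage ψ 0 1 =
      1 / (2 * Real.pi) * ∫ ω in Set.Ico (-Real.pi) Real.pi, ψ (circleMap 0 1 ω) := by
    have hper : (fun ω : ℝ => ψ (circleMap 0 1 ω)).Periodic (2 * Real.pi) := fun ω => by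
      simp [periodic_circleMap 0 1 ω]
    have := hper.intervalIntegral_add_eq 0 (-Real.pi)
    rw [show -Real.pi + 2 * Real.pi = Real.pi by ring, zero_add] at this
    rw [Real.circleAverage_def, this, intervalIntegral.integral_of_le (by linarith),
      ← MeasureTheory.integral_Ico_eq_integral_Ioc, smul_eq_mul, one_div]
  rw [havg, ENNReal.ofReal_mul (by positivity),
    MeasureTheory.ofReal_integral_eq_lintegral_ofReal hint
      (Filter.Eventually.of_forall fun ω => (h0 _ (hn ω)).trans (h1 _ (hn ω)))]
  gcongr with ω
  rw [hc]
  exact h1 _ (hn ω)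

/-! ### The `H₂` bound from a Lyapunov inequality -/

/-- Pointwise form of the `H₂` bound. With `R = (z - F)⁻¹` and `|z| = 1`, the relation
`R F = z R - 1` turns `R (W - F W Fᴴ) Rᴴ` into `z R W + (z R W)ᴴ - W`. -/
lemma trace_gram_resolvent_le {ι κ ν : Type*} [Fintype ι] [DecidableEq ι] [Fintype κ] [Fintype ν]
    {W F : Matrix ι ι ℂ} {E : Matrix ι ν ℂ} (L : Matrix κ ι ℂ) (hW : W.IsHermitian)
    (h : (W - F * W * Fᴴ - E * Eᴴ).PosSemidef) {z : ℂ} (hz : ‖z‖ = 1)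
    (hu : IsUnit (z • (1 : Matrix ι ι ℂ) - F)) :
    ((L * (z • 1 - F)⁻¹ * E)ᴴ * (L * (z • 1 - F)⁻¹ * E)).trace.re ≤
      2 * (L * (z • (z • 1 - F)⁻¹) * (W * Lᴴ)).trace.re - (L * W * Lᴴ).trace.re := by
  have hzz : star z * z = 1 := by
    have := Complex.conj_mul' z
    rw [hz] at this
    simpa using this
  set R := (z • (1 : Matrix ι ι ℂ) - F)⁻¹ with hR
  have hRF : R * F = z • R - 1 := by
    have h1 : R * (z • 1 - F) = 1 :=
      Matrix.nonsing_inv_mul _ ((Matrix.isUnit_iff_isUnit_det _).mp hu)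
    rw [Matrix.mul_sub, Matrix.mul_smul, Matrix.mul_one] at h1
    rw [← h1]
    abel
  have hFR : Fᴴ * Rᴴ = star z • Rᴴ - 1 := by
    have := congrArg Matrix.conjTranspose hRF
    simpa [Matrix.conjTranspose_mul] using this
  have hQ := (h.mul_mul_conjTranspose_same (L * R)).trace_nonneg
  have key : L * R * (W - F * W * Fᴴ - E * Eᴴ) * (L * R)ᴴ =
      L * (z • R) * (W * Lᴴ) + (L * (z • R) * (W * Lᴴ))ᴴ - L * W * Lᴴ
        - (L * R * E) * (L * R * E)ᴴ := by
    have e : R * (F * W * Fᴴ) * Rᴴ = R * W * Rᴴ - z • (R * W) - star z • (W * Rᴴ) + W := by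
      calc R * (F * W * Fᴴ) * Rᴴ = (R * F) * W * (Fᴴ * Rᴴ) := by simp only [Matrix.mul_assoc]
        _ = (z • R - 1) * W * (star z • Rᴴ - 1) := by rw [hRF, hFR]
        _ = (star z * z) • (R * W * Rᴴ) - z • (R * W) - star z • (W * Rᴴ) + W := by
          simp only [Matrix.sub_mul, Matrix.mul_sub, Matrix.smul_mul, Matrix.mul_smul,
            Matrix.one_mul, Matrix.mul_one]
          module
        _ = _ := by rw [hzz, one_smul]
    have e' : L * R * (W - F * W * Fᴴ - E * Eᴴ) * (L * R)ᴴ =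
        L * (R * W * Rᴴ - R * (F * W * Fᴴ) * Rᴴ) * Lᴴ - (L * R * E) * (L * R * E)ᴴ := by
      simp only [Matrix.conjTranspose_mul, Matrix.mul_sub, Matrix.sub_mul, Matrix.mul_assoc]
    rw [e', e]
    simp only [Matrix.conjTranspose_mul, Matrix.conjTranspose_smul,
      Matrix.conjTranspose_conjTranspose, hW.eq, Matrix.mul_sub, Matrix.sub_mul, Matrix.mul_add,
      Matrix.add_mul, Matrix.mul_smul, Matrix.smul_mul, Matrix.mul_assoc]
    abel
  rw [key, Matrix.trace_sub, Matrix.trace_sub, Matrix.trace_add, Matrix.trace_conjTranspose,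
    Matrix.trace_mul_comm (L * R * E)] at hQ
  have := (Complex.le_def.mp hQ).1
  simp only [Complex.zero_re, Complex.sub_re, Complex.add_re, Complex.star_def,
    Complex.conj_re] at this
  linarith

/-- If `W ≥ F W Fᴴ + E Eᴴ`, then `W` dominates the controllability Gramian, so that
`‖L (z - F)⁻¹ E‖₂² ≤ Tr (L W Lᴴ)`. -/
lemma h2Norm_sq_le {n m q : ℕ} {W F : Matrix (Fin n) (Fin n) ℂ} {E : Matrix (Fin n) (Fin m) ℂ}
    (L : Matrix (Fin q) (Fin n) ℂ) (hW : W.IsHermitian)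
    (h : (W - F * W * Fᴴ - E * Eᴴ).PosSemidef) (hF : ∀ z ∈ spectrum ℂ F, ‖z‖ < 1) :
    h2Norm (fun z => L * (z • 1 - F)⁻¹ * E) ^ 2 ≤ ENNReal.ofReal (L * W * Lᴴ).trace.re := by
  set g : ℂ → ℂ := fun w => (L * (1 - w • F)⁻¹ * (W * Lᴴ)).trace with hg
  have hgc : ContinuousOn g (Metric.sphere 0 1) := fun w hw =>
    (differentiableAt_trace_mul_inv_mul hF L (W * Lᴴ)
      (by simpa using hw.le)).continuousAt.continuousWithinAt
  have hgi : ContinuousOn (fun z : ℂ => g z⁻¹) (Metric.sphere 0 1) := by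
    refine hgc.comp (continuousOn_inv₀.mono fun z hz => ?_) fun z hz => ?_
    · exact Metric.ne_of_mem_sphere hz one_ne_zero
    · simpa using hz
  have hgre : ContinuousOn (fun z : ℂ => (g z⁻¹).re) (Metric.sphere 0 1) :=
    Complex.continuous_re.comp_continuousOn hgi
  have hu : ∀ z : ℂ, ‖z‖ = 1 → IsUnit (z • (1 : Matrix (Fin n) (Fin n) ℂ) - F) := by
    intro z hz
    have : z ∉ spectrum ℂ F := fun hs => (hF z hs).ne hz
    rwa [spectrum.notMem_iff, Algebra.algebraMap_eq_smul_one] at this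
  have hres : ∀ z : ℂ, ‖z‖ = 1 →
      z • (z • (1 : Matrix (Fin n) (Fin n) ℂ) - F)⁻¹ = (1 - z⁻¹ • F)⁻¹ := by
    intro z hz
    have hz0 : z ≠ 0 := norm_ne_zero_iff.mp (by simp [hz])
    refine (Matrix.inv_eq_right_inv ?_).symm
    have e : (1 : Matrix (Fin n) (Fin n) ℂ) - z⁻¹ • F = z⁻¹ • (z • 1 - F) := by
      rw [smul_sub, smul_smul, inv_mul_cancel₀ hz0, one_smul]
    rw [e, Matrix.smul_mul, Matrix.mul_smul, smul_smul, inv_mul_cancel₀ hz0, one_smul,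
      Matrix.mul_nonsing_inv _ ((Matrix.isUnit_iff_isUnit_det _).mp (hu z hz))]
  have havg : Real.circleAverage (fun z : ℂ => 2 * (g z⁻¹).re - (L * W * Lᴴ).trace.re) 0 1 =
      (L * W * Lᴴ).trace.re := by
    have hi : CircleIntegrable (fun z : ℂ => g z⁻¹) 0 1 := hgi.circleIntegrable zero_le_one
    have hir : CircleIntegrable (fun z : ℂ => (g z⁻¹).re) 0 1 := hgre.circleIntegrable zero_le_one
    have h1 : Real.circleAverage (fun z : ℂ => (g z⁻¹).re) 0 1 = (L * W * Lᴴ).trace.re := by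
      have h2 := Complex.reCLM.circleAverage_comp_comm hi
      have h3 : Real.circleAverage (fun z : ℂ => g z⁻¹) 0 1 = (L * W * Lᴴ).trace := by
        rw [Real.circleAverage_zero_one_congr_inv, hg, circleAverage_trace_mul_inv_mul hF,
          Matrix.mul_assoc]
      rw [h3] at h2
      exact h2
    have h4 : (fun z : ℂ => 2 * (g z⁻¹).re - (L * W * Lᴴ).trace.re) =
        fun z : ℂ => (2 : ℝ) • (g z⁻¹).re - (L * W * Lᴴ).trace.re := rfl
    rw [h4, Real.circleAverage_fun_sub (hir.const_fun_smul) (circleIntegrable_const _ _ _),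
      Real.circleAverage_fun_smul, h1, Real.circleAverage_const, smul_eq_mul]
    ring
  have hmain := lintegral_le_circleAverage
    (φ := fun z => ((L * (z • 1 - F)⁻¹ * E)ᴴ * (L * (z • 1 - F)⁻¹ * E)).trace.re)
    (ψ := fun z => 2 * (g z⁻¹).re - (L * W * Lᴴ).trace.re)
    (fun z _ => (Complex.le_def.mp
      (Matrix.posSemidef_conjTranspose_mul_self _).trace_nonneg).1)
    (fun z hz => by
      have := trace_gram_resolvent_le L hW h hz (hu z hz)
      rwa [hres z hz] at this)
    ((hgre.const_smul (2 : ℝ)).sub continuousOn_const)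
  rw [havg] at hmain
  unfold h2Norm
  -- The outer square cancels the exponent `1 / 2` in the definition of the norm.
  rw [← ENNReal.rpow_natCast, ← ENNReal.rpow_mul]
  norm_num
  simpa using hmain

/-! ### The `H∞` bound -/

lemma hinfNorm_sq_le {q m : ℕ} {T : ℂ → Matrix (Fin q) (Fin m) ℂ} {γ : ℝ} (hγ : 0 ≤ γ)
    (h : ∀ z : ℂ, ‖z‖ = 1 → ((γ : ℂ) • 1 - (T z)ᴴ * T z).PosSemidef) :
    hinfNorm T ^ 2 ≤ ENNReal.ofReal γ := by
  have h1 : hinfNorm T ≤ ENNReal.ofReal √γ := by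
    refine essSup_le_of_ae_le _ (Filter.Eventually.of_forall fun ω => ?_)
    refine ENNReal.ofReal_le_ofReal (Real.le_sqrt_of_sq_le (sigmaMax_sq_le _ hγ (h _ ?_)))
    rw [mul_comm]
    exact Complex.norm_exp_ofReal_mul_I ω
  calc hinfNorm T ^ 2 ≤ ENNReal.ofReal √γ ^ 2 := by gcongr
    _ = ENNReal.ofReal γ := by
      rw [← ENNReal.ofReal_pow (Real.sqrt_nonneg _), Real.sq_sqrt hγ]

/-! ### Consequences of the matrix inequalities for the gain `X⁻¹ Ĝ` -/

namespace Participant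

variable {nx nw ny nz : ℕ} {P : Participant nx nw ny nz} {X Y : Matrix (Fin nx) (Fin nx) ℝ}
  {Ghat : Matrix (Fin nx) (Fin ny) ℝ}

lemma posDef_of_couplingBlock (h : (couplingBlock X Y).PosDef) : X.PosDef :=
  h.submatrix Sum.inr_injective

lemma posSemidef_sub_inv_of_couplingBlock (h : (couplingBlock X Y).PosDef) :
    (Y - X⁻¹).PosSemidef := by
  have hX := posDef_of_couplingBlock h
  have := hX.isUnit.invertible
  have h1 := (Matrix.PosDef.fromBlocks₂₂ Y 1 hX).mp (by simpa [couplingBlock] using h.posSemidef)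
  simpa using h1

/-- The change of variables `Ĝ = X G`, applied to `A - G C` and `B - G D`. -/
lemma mul_inv_gain {m : ℕ} (hX : X.PosDef) (K : Matrix (Fin nx) (Fin m) ℝ)
    (N : Matrix (Fin ny) (Fin m) ℝ) :
    X * (K - X⁻¹ * Ghat * N) = X * K - Ghat * N := by
  have hu := (Matrix.isUnit_iff_isUnit_det _).mp hX.isUnit
  rw [Matrix.mul_sub, Matrix.mul_assoc X⁻¹, Matrix.mul_nonsing_inv_cancel_left _ _ hu]

/-- Testing `h2Block` on the columns of `[-F; 1; 0]` gives the Lyapunov inequality `Fᵀ X F < X`. -/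
lemma lyapunov_of_h2Block (hX : X.PosDef) (h : (P.h2Block X Ghat).PosDef) :
    (X - (P.A - X⁻¹ * Ghat * P.C)ᵀ * X * (P.A - X⁻¹ * Ghat * P.C)).PosDef := by
  set F := P.A - X⁻¹ * Ghat * P.C with hF
  have hXF : X * P.A - Ghat * P.C = X * F := (mul_inv_gain hX _ _).symm
  have hXt : Xᵀ = X := by simpa using hX.isHermitian.eq
  set V : Matrix (Fin nx ⊕ (Fin nx ⊕ Fin nw)) (Fin nx) ℝ :=
    Matrix.fromRows (-F) (Matrix.fromRows 1 0) with hV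
  have hinj : Function.Injective V.mulVec := fun v w hvw => by
    have h1 := congrArg (fun u => fun i => u (Sum.inr (Sum.inl i))) hvw
    simpa [hV, Matrix.fromRows_mulVec] using h1
  have h1 := h.conjTranspose_mul_mul_same hinj
  have key : Vᴴ * P.h2Block X Ghat * V = X - Fᵀ * X * F := by
    rw [Matrix.mul_assoc, h2Block, hXF, hV]
    simp only [Matrix.conjTranspose_fromRows_eq_fromCols_conjTranspose,
      Matrix.fromBlocks_mul_fromRows, Matrix.fromCols_mul_fromRows, Matrix.fromRows_mul]
    simp only [Matrix.mul_add, Matrix.fromCols_mul_fromRows]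
    simp [hXt, Matrix.mul_assoc, sub_eq_add_neg, add_comm]
  rwa [key] at h1

/-- The Schur complement of `h2Block`, in the variable `X⁻¹`. -/
lemma gramian_le_of_h2Block (hX : X.PosDef) (h : (P.h2Block X Ghat).PosDef) :
    (X⁻¹ - (P.A - X⁻¹ * Ghat * P.C) * X⁻¹ * (P.A - X⁻¹ * Ghat * P.C)ᵀ
      - (P.B - X⁻¹ * Ghat * P.D) * (P.B - X⁻¹ * Ghat * P.D)ᵀ).PosSemidef := by
  set F := P.A - X⁻¹ * Ghat * P.C with hF
  set E := P.B - X⁻¹ * Ghat * P.D with hE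
  have hXF : X * P.A - Ghat * P.C = X * F := (mul_inv_gain hX _ _).symm
  have hXE : X * P.B - Ghat * P.D = X * E := (mul_inv_gain hX _ _).symm
  have hXt : Xᵀ = X := by simpa using hX.isHermitian.eq
  have hXit : X⁻¹ᵀ = X⁻¹ := by rw [Matrix.transpose_nonsing_inv, hXt]
  have hu := (Matrix.isUnit_iff_isUnit_det _).mp hX.isUnit
  have hD : (Matrix.fromBlocks X 0 0 (1 : Matrix (Fin nw) (Fin nw) ℝ)).PosDef :=
    h.submatrix (e := Sum.inr) Sum.inr_injective
  have hDinv : (Matrix.fromBlocks X 0 0 (1 : Matrix (Fin nw) (Fin nw) ℝ))⁻¹ =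
      Matrix.fromBlocks X⁻¹ 0 0 1 := by
    refine Matrix.inv_eq_right_inv ?_
    simp [Matrix.fromBlocks_multiply, Matrix.mul_nonsing_inv _ hu]
  have := hD.isUnit.invertible
  have h1 := (Matrix.PosDef.fromBlocks₂₂ X (Matrix.fromCols (X * F) (X * E)) hD).mp (by
    have h2 := h.posSemidef
    rw [h2Block, hXF, hXE] at h2
    rwa [Matrix.conjTranspose_fromCols_eq_fromRows_conjTranspose,
      Matrix.conjTranspose_eq_transpose_of_trivial,
      Matrix.conjTranspose_eq_transpose_of_trivial])
  have h2 := h1.mul_mul_conjTranspose_same X⁻¹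
  rw [hDinv] at h2
  refine (congrArg Matrix.PosSemidef ?_).mp h2
  rw [Matrix.conjTranspose_fromCols_eq_fromRows_conjTranspose]
  simp only [Matrix.fromCols_mul_fromBlocks, Matrix.fromCols_mul_fromRows,
    Matrix.conjTranspose_eq_transpose_of_trivial, Matrix.transpose_mul, hXt, hXit, Matrix.mul_zero,
    Matrix.mul_one, add_zero, zero_add, Matrix.mul_sub, Matrix.sub_mul, Matrix.mul_add,
    Matrix.add_mul, Matrix.mul_assoc, Matrix.nonsing_inv_mul_cancel_left _ _ hu,
    Matrix.mul_nonsing_inv _ hu]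
  abel

lemma isStable_filter_of_h2Block (hX : X.PosDef) (h : (P.h2Block X Ghat).PosDef) :
    ∀ z ∈ spectrum ℂ (toComplex (P.A - X⁻¹ * Ghat * P.C)), ‖z‖ < 1 := by
  intro z hz
  refine norm_lt_one_of_lyapunov (X := toComplex X) hX.map_ofReal ?_ hz
  rw [← toComplex_transpose, ← toComplex_mul, ← toComplex_mul, ← toComplex_sub]
  exact (lyapunov_of_h2Block hX h).map_ofReal

lemma h2Constraint_of_LMIs {μ ρ lam : ℝ} (h : P.LMIs μ ρ lam X Y Ghat) :
    P.H2Constraint (X⁻¹ * Ghat) μ := by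
  obtain ⟨hμ, hc, h2, -⟩ := h
  have hX := posDef_of_couplingBlock hc
  have hF := isStable_filter_of_h2Block hX h2
  refine ⟨hF, ?_⟩
  set F := P.A - X⁻¹ * Ghat * P.C with hFdef
  set E := P.B - X⁻¹ * Ghat * P.D with hE
  have hT : (P.errorSystem (X⁻¹ * Ghat)).transfer =
      fun z => toComplex P.L * (z • 1 - toComplex F)⁻¹ * toComplex E := by
    funext z
    simp [StateSpace.transfer, errorSystem, toComplex_zero, hFdef, hE]
  have h3 := h2Norm_sq_le (W := toComplex X⁻¹) (F := toComplex F) (E := toComplex E)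
    (toComplex P.L) hX.inv.map_ofReal.isHermitian (by
      simp only [← toComplex_transpose, ← toComplex_mul, ← toComplex_sub]
      exact (gramian_le_of_h2Block hX h2).map_ofReal) hF
  rw [← toComplex_transpose, ← toComplex_mul, ← toComplex_mul, trace_toComplex,
    Complex.ofReal_re] at h3
  have hY : (P.L * X⁻¹ * P.Lᵀ).trace ≤ (Y * P.Lᵀ * P.L).trace := by
    have h4 := ((posSemidef_sub_inv_of_couplingBlock hc).mul_mul_conjTranspose_same P.L).trace_nonneg
    rw [Matrix.mul_sub, Matrix.sub_mul, Matrix.trace_sub,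
      Matrix.conjTranspose_eq_transpose_of_trivial] at h4
    have h5 : (P.L * Y * P.Lᵀ).trace = (Y * P.Lᵀ * P.L).trace := by
      rw [Matrix.mul_assoc, Matrix.trace_mul_comm]
    linarith
  have h0 : 0 ≤ (P.L * X⁻¹ * P.Lᵀ).trace :=
    (hX.inv.posSemidef.mul_mul_conjTranspose_same P.L).trace_nonneg
  rw [hT]
  refine (EReal.coe_ennreal_le_coe_ennreal_iff.mpr h3).trans ?_
  rw [EReal.coe_ennreal_ofReal, max_eq_left h0]
  exact_mod_cast hY.trans hμ.le

lemma hinfConstraint_of_LMIs (hnz : 0 < nz) {μ ρ lam : ℝ} (hρ : 0 < ρ)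
    (h : P.LMIs μ ρ lam X Y Ghat) :
    P.HinfConstraint (X⁻¹ * Ghat) ρ lam := by
  obtain ⟨-, hc, h2, hinf⟩ := h
  have hX := posDef_of_couplingBlock hc
  have hF := isStable_filter_of_h2Block hX h2
  refine ⟨hF, ?_⟩
  set F := P.A - X⁻¹ * Ghat * P.C with hFdef
  set M := X⁻¹ * Ghat * P.C * P.S with hM
  have hXF : X * P.A - Ghat * P.C = X * F := (mul_inv_gain hX _ _).symm
  have hXM : Ghat * P.C * P.S = X * M := by
    have hu := (Matrix.isUnit_iff_isUnit_det _).mp hX.isUnit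
    simp only [hM, Matrix.mul_assoc, Matrix.mul_nonsing_inv_cancel_left _ _ hu]
  -- The block `(lam / ρ²) I` is nonempty because `nz > 0`; this makes `lam` positive.
  have hγ : 0 < lam / ρ ^ 2 := by
    have := hinf.diag_pos (i := Sum.inl (Sum.inr ⟨0, hnz⟩))
    simpa [hinfBlock] using this
  have hblock := hinf.posSemidef.map_ofReal
  have hT : (P.sensitivitySystem (X⁻¹ * Ghat)).transfer =
      fun z => toComplex P.L * (z • 1 - toComplex F)⁻¹ * toComplex M := by
    funext z
    simp [StateSpace.transfer, sensitivitySystem, filter, toComplex_zero, hFdef, hM]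
  have hB : (Matrix.fromBlocks
      (Matrix.fromBlocks (toComplex X) 0 0
        (((lam / ρ ^ 2 : ℝ) : ℂ) • (1 : Matrix (Fin nz) (Fin nz) ℂ)))
      (Matrix.fromBlocks (toComplex X * toComplex F) (toComplex X * toComplex M) (toComplex P.L) 0)
      (Matrix.fromBlocks (toComplex X * toComplex F) (toComplex X * toComplex M)
        (toComplex P.L) 0)ᴴ
      (Matrix.fromBlocks (toComplex X) 0 0 (1 : Matrix (Fin nx) (Fin nx) ℂ))).PosSemidef := by
    convert hblock using 1
    rw [hinfBlock, hXF, hXM]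
    simp only [Matrix.fromBlocks_map, Matrix.fromBlocks_transpose,
      Matrix.fromBlocks_conjTranspose, ← toComplex_mul, ← toComplex_transpose]
    simp [toComplex, Matrix.smul_one_eq_diagonal, Matrix.diagonal_map]
  have h3 : hinfNorm (P.sensitivitySystem (X⁻¹ * Ghat)).transfer ^ 2 ≤
      ENNReal.ofReal (lam / ρ ^ 2) := by
    rw [hT]
    refine hinfNorm_sq_le hγ.le fun z hz => ?_
    have hu : IsUnit (z • (1 : Matrix (Fin nx) (Fin nx) ℂ) - toComplex F) := by
      have : z ∉ spectrum ℂ (toComplex F) := fun hs => (hF z hs).ne hz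
      rwa [spectrum.notMem_iff, Algebra.algebraMap_eq_smul_one] at this
    have hx : toComplex F * ((z • 1 - toComplex F)⁻¹ * toComplex M) + toComplex M =
        z • ((z • 1 - toComplex F)⁻¹ * toComplex M) := by
      have h4 := Matrix.mul_nonsing_inv_cancel_left _ (toComplex M)
        ((Matrix.isUnit_iff_isUnit_det _).mp hu)
      rw [Matrix.sub_mul, Matrix.smul_mul, Matrix.one_mul, sub_eq_iff_eq_add] at h4
      rw [h4, add_comm]
    rw [Matrix.mul_assoc]
    exact boundedReal_posSemidef hγ hB hX.map_ofReal.isHermitian hz hx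
  have h5 : ENNReal.ofReal (ρ ^ 2) * hinfNorm (P.sensitivitySystem (X⁻¹ * Ghat)).transfer ^ 2 ≤
      ENNReal.ofReal lam := by
    calc _ ≤ ENNReal.ofReal (ρ ^ 2) * ENNReal.ofReal (lam / ρ ^ 2) := by gcongr
      _ = ENNReal.ofReal lam := by
        rw [← ENNReal.ofReal_mul (by positivity), mul_div_cancel₀ _ (by positivity)]
  have hlam : 0 ≤ lam := by
    have := (div_pos_iff_of_pos_right (by positivity : 0 < ρ ^ 2)).mp hγ
    exact this.le
  refine (EReal.coe_ennreal_le_coe_ennreal_iff.mpr h5).trans ?_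
  rw [EReal.coe_ennreal_ofReal, max_eq_left hlam]

end Participant

end

theorem mainTheorem4 {n : ℕ} (nx nw ny : Fin n → ℕ) (nz : ℕ) (hnz : 0 < nz)
    (P : ∀ i : Fin n, Participant (nx i) (nw i) (ny i) nz)
    (ρ μ : Fin n → ℝ) (lam : ℝ) (i : Fin n) (hρ : 0 < ρ i) :
    ((∃ (X Y : Matrix (Fin (nx i)) (Fin (nx i)) ℝ) (Ghat : Matrix (Fin (nx i)) (Fin (ny i)) ℝ),
        (P i).LMIs (μ i) (ρ i) lam X Y Ghat) →
      ∃ G : Matrix (Fin (nx i)) (Fin (ny i)) ℝ,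
        (P i).H2Constraint G (μ i) ∧ (P i).HinfConstraint G (ρ i) lam) ∧
    (∀ (X Y : Matrix (Fin (nx i)) (Fin (nx i)) ℝ) (Ghat : Matrix (Fin (nx i)) (Fin (ny i)) ℝ),
      (P i).LMIs (μ i) (ρ i) lam X Y Ghat →
        (P i).H2Constraint (X⁻¹ * Ghat) (μ i) ∧
          (P i).HinfConstraint (X⁻¹ * Ghat) (ρ i) lam) := by
  have key : ∀ (X Y : Matrix (Fin (nx i)) (Fin (nx i)) ℝ)
      (Ghat : Matrix (Fin (nx i)) (Fin (ny i)) ℝ), (P i).LMIs (μ i) (ρ i) lam X Y Ghat →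
        (P i).H2Constraint (X⁻¹ * Ghat) (μ i) ∧ (P i).HinfConstraint (X⁻¹ * Ghat) (ρ i) lam :=
    fun _ _ _ h => ⟨Participant.h2Constraint_of_LMIs h,
      Participant.hinfConstraint_of_LMIs hnz hρ h⟩
  exact ⟨fun ⟨X, Y, Ghat, h⟩ => ⟨X⁻¹ * Ghat, key X Y Ghat h⟩, key⟩
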